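/- For $0<r<1$ let $$\mathcal K(r)=\int_0^1\frac{dx}{\sqrt{(1-x^2)(1-r^2x^2)}}$$ be the complete elliptic integral of the first kind. For $t\in\mathbb R$ put $$h(t)=\frac{\pi}{8\,\mathcal K\big(1/\sqrt{1+e^{t}}\big)\,\mathcal K\big(1/\sqrt{1+e^{-t}}\big)},\qquad H(t)=\frac1{h(t)},\qquad C_0=\frac{\Gamma(1/4)^4}{4\pi^2}.$$ (It is well known that $h(t)=e^t\lambda_{0,1}(-e^t)$, where $\lambda_{0,1}$ is the density of the hyperbolic metric of curvature $-4$ of $\mathbb C\setminus\{0,1\}$; this background identity is not part of the assertion.) Then: 1. The function $t\,h(t)$ is strictly increasing from $(0,\infty)$ onto $(0,1/2)$. 2. The function $H$ is even and twice differentiable on $\mathbb R$, satisfies $H''(t)>0$ for all $t\in\mathbb R$, is strictly convex on $\mathbb R$, and maps $[0,\infty)$ homeomorphically onto $[2C_0,\infty)$. 3. The derivative $H'$ is odd and maps $\mathbb R$ homeomorphically onto the interval $(-2,2)$. 4. $2(|t|+C_0)\,h(t)<1.25$ for all $t\in\mathbb R$. 5. For all $t\in\mathbb R$, $$\frac1{|t|+C_0}\le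 2h(t)<\frac1{|t|+\log 16},$$ and equality holds in the left inequality if and only if $t=0$. -/

import Mathlib

/-- The complete elliptic integral of the first kind
`K(r) = ∫₀¹ dx / √((1 - x²)(1 - r²x²))`, for a modulus `0 < r < 1`. -/
noncomputable def ellipticK (r : ℝ) : ℝ :=
  ∫ x in (0 : ℝ)..1, 1 / Real.sqrt ((1 - x ^ 2) * (1 - r ^ 2 * x ^ 2))

/-- `h(t) = π / [8 K(1/√(1+eᵗ)) K(1/√(1+e⁻ᵗ))]`. -/
noncomputable def hFun (t : ℝ) : ℝ :=
  Real.pi / (8 * ellipticK (1 / Real.sqrt (1 + Real.exp t)) *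
    ellipticK (1 / Real.sqrt (1 + Real.exp (-t))))

/-- `H = 1/h`. -/
noncomputable def HFun (t : ℝ) : ℝ := 1 / hFun t

/-- The constant `C₀ = Γ(1/4)⁴ / (4π²)`. -/
noncomputable def hempelC : ℝ := Real.Gamma (1 / 4) ^ 4 / (4 * Real.pi ^ 2)

/-!
Write `K` as a function `u(t) = K(1/√(1+e⁻ᵗ))` of the logarithmic variable `t` (`logK`), so that
`H(t) = (8/π) u(t) u(-t)`. The idea is that Legendre's equation, read in this variable, is the
Schrödinger-type equation `u'' = q u` with the even potential `q = 1 / (16 cosh²(t/2))`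
(`hasDerivAt_logK'`).

*Convexity.* Put `v(t) = u(-t)`. Then `(uv)'' = 2G` with `G = q u v + u' v'`, and the equation gives
`G' = q u v (q'/q + 2 u'/u + 2 v'/v)`. The bracket vanishes at `t = 0`, and the Riccati equation for
the logarithmic derivatives shows that its derivative is negative; hence `G` decreases on `[0, ∞)`.
Since `G` tends to `0` at infinity and is even, it is positive (`convexityForm_pos`).

*Asymptotics.* Splitting the integral for `K` into an elementary part and a dominated remainder
gives `u(t) = t/2 + log 4 + o(1)` (`tendsto_logK_sub`), while `v(t) = π/2 + O(e⁻ᵗ)`; hence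
`H(t) - 2t → 2 log 16`. Convexity then forces `H' → 2` and `H' < 2`, so `H - 2t` decreases strictly
from `H(0)` to `2 log 16`. The value `H(0) = 2 C₀` is the lemniscatic case, obtained from the Beta
integral `B(1/4, 1/4)`. This gives the two-sided estimate and, through `H - t H' > H - 2t > 0`, the
monotonicity of `t h(t)`.

*The constant 1.25.* The claim is `H(t) > (8/5) (t + C₀)` for `t ≥ 0`, where the minimal gap is
about `0.047`, at `t ≈ 2.5`. With `m = 1/(1+eᵗ)`, the function `y = (1/2) log(16/m) (1 + m/4) - m/4`
satisfies `y'' ≤ q y` and is asymptotic to `u`, so `y ≤ u` by Sturm comparison from infinity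
(`logKMinorant_le`). Together with `v ≥ (π/2)(1 + m/4)` and `C₀ < 4.3811` this leaves an inequality
in `m` and `log m` alone (`minorant_ineq`).
-/

open Real Set Filter Topology MeasureTheory

/-! ### The elliptic integral as a function of the parameter -/

/-- The integral `∫₀^{π/2} sin²ʲθ (1 - m sin²θ)⁻ᵃ dθ`, as a function of the parameter `m`
(the square of the modulus). The case `j = 0`, `a = 1/2` is the complete elliptic integral of the
first kind, and the family is closed under differentiation in `m`. -/
noncomputable def ellipticMoment (j : ℕ) (a m : ℝ) : ℝ :=
  ∫ θ in (0 : ℝ)..(π / 2), sin θ ^ (2 * j) * (1 - m * sin θ ^ 2) ^ (-a)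

theorem one_sub_mul_sin_sq_pos {m : ℝ} (hm : m < 1) (θ : ℝ) : 0 < 1 - m * sin θ ^ 2 := by
  rcases le_total m 0 with h | h <;> nlinarith [sq_nonneg (sin θ), sin_sq_le_one θ]

theorem continuous_ellipticMoment_integrand (j : ℕ) (a : ℝ) {m : ℝ} (hm : m < 1) :
    Continuous fun θ : ℝ => sin θ ^ (2 * j) * (1 - m * sin θ ^ 2) ^ (-a) := by
  refine (by fun_prop : Continuous fun θ : ℝ => sin θ ^ (2 * j)).mul ?_
  exact (by fun_prop : Continuous fun θ : ℝ => 1 - m * sin θ ^ 2).rpow_const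
    fun θ => Or.inl (one_sub_mul_sin_sq_pos hm θ).ne'

theorem hasDerivAt_ellipticMoment (j : ℕ) {a m : ℝ} (ha : 0 ≤ a) (hm : m < 1) :
    HasDerivAt (ellipticMoment j a) (a * ellipticMoment (j + 1) (a + 1) m) m := by
  -- On `x < (1 + m) / 2` the base `1 - x sin²θ` is at least `min ((1 - m) / 2) 1`; the second bound
  -- serves for negative `x`.
  set δ : ℝ := (1 - m) / 2 with hδ
  have hδ0 : 0 < δ := by rw [hδ]; linarith
  have hs : Iio ((1 + m) / 2) ∈ 𝓝 m := Iio_mem_nhds (by linarith)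
  have hlow : ∀ x ∈ Iio ((1 + m) / 2), ∀ θ : ℝ, min δ 1 ≤ 1 - x * sin θ ^ 2 := by
    intro x hx θ
    have hx' : x < (1 + m) / 2 := hx
    rcases le_total x 0 with h | h
    · exact (min_le_right _ _).trans (by nlinarith [sq_nonneg (sin θ)])
    · refine (min_le_left _ _).trans ?_
      rw [hδ]
      nlinarith [sq_nonneg (sin θ), sin_sq_le_one θ]
  have hmin : 0 < min δ 1 := lt_min hδ0 one_pos
  have key := intervalIntegral.hasDerivAt_integral_of_dominated_loc_of_deriv_le (μ := volume)
    (a := 0) (b := π / 2) (x₀ := m) (s := Iio ((1 + m) / 2))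
    (F := fun x θ => sin θ ^ (2 * j) * (1 - x * sin θ ^ 2) ^ (-a))
    (F' := fun x θ => a * (sin θ ^ (2 * (j + 1)) * (1 - x * sin θ ^ 2) ^ (-(a + 1))))
    (bound := fun _ => a * (min δ 1) ^ (-(a + 1))) hs ?_ ?_ ?_ ?_ ?_ ?_
  · have h2 := key.2
    rw [intervalIntegral.integral_const_mul] at h2
    exact h2
  · filter_upwards [hs] with x hx
    exact (continuous_ellipticMoment_integrand j a
      (lt_trans hx (by linarith))).aestronglyMeasurable
  · exact (continuous_ellipticMoment_integrand j a hm).intervalIntegrable _ _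
  · exact ((continuous_ellipticMoment_integrand (j + 1) (a + 1)
      hm).const_mul a).aestronglyMeasurable
  · refine Eventually.of_forall fun θ _ x hx => ?_
    have h1 := hlow x hx θ
    have h0 : 0 < 1 - x * sin θ ^ 2 := hmin.trans_le h1
    rw [norm_mul, norm_mul, norm_of_nonneg ha, norm_of_nonneg (rpow_nonneg h0.le _), norm_pow]
    have h2 : (1 - x * sin θ ^ 2) ^ (-(a + 1)) ≤ (min δ 1) ^ (-(a + 1)) :=
      rpow_le_rpow_of_nonpos hmin h1 (by linarith)
    have h3 : ‖sin θ‖ ^ (2 * (j + 1)) ≤ 1 := pow_le_one₀ (norm_nonneg _) (abs_sin_le_one θ)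
    have h4 := rpow_nonneg h0.le (-(a + 1))
    gcongr
    calc ‖sin θ‖ ^ (2 * (j + 1)) * (1 - x * sin θ ^ 2) ^ (-(a + 1))
        ≤ 1 * (1 - x * sin θ ^ 2) ^ (-(a + 1)) := by gcongr
      _ ≤ _ := by rw [one_mul]; exact h2
  · exact intervalIntegrable_const
  · refine Eventually.of_forall fun θ _ x hx => ?_
    have h0 : 0 < 1 - x * sin θ ^ 2 := hmin.trans_le (hlow x hx θ)
    have h1 : HasDerivAt (fun x : ℝ => 1 - x * sin θ ^ 2) (-(sin θ ^ 2)) x := by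
      simpa using ((hasDerivAt_id x).mul_const (sin θ ^ 2)).const_sub 1
    have h2 := (h1.rpow_const (p := -a) (Or.inl h0.ne')).const_mul (sin θ ^ (2 * j))
    refine h2.congr_deriv ?_
    rw [show -a - 1 = -(a + 1) by ring]
    ring

theorem ellipticMoment_pos (j : ℕ) (a : ℝ) {m : ℝ} (hm : m < 1) : 0 < ellipticMoment j a m := by
  refine intervalIntegral.intervalIntegral_pos_of_pos_on
    ((continuous_ellipticMoment_integrand j a hm).intervalIntegrable _ _) (fun θ hθ => ?_)
    (by positivity)
  have := sin_pos_of_pos_of_lt_pi hθ.1 (by linarith [hθ.2, pi_pos])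
  have := one_sub_mul_sin_sq_pos hm θ
  positivity

/-- Legendre's equation `(m (1 - m) K')' = K / 4`, written out for the derivatives of `K`. -/
theorem ellipticMoment_legendre {m : ℝ} (hm : m < 1) :
    m * (1 - m) * (3 / 4 * ellipticMoment 2 (5 / 2) m)
      + (1 - 2 * m) * (1 / 2 * ellipticMoment 1 (3 / 2) m)
      = 1 / 4 * ellipticMoment 0 (1 / 2) m := by
  -- The difference of the integrands is the derivative of `-(sin θ cos θ) / (4 Δ³)`, where
  -- `Δ² = 1 - m sin²θ`, and this function vanishes at both ends.
  have hd : ∀ θ : ℝ, HasDerivAt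
      (fun θ : ℝ => -(1 / 4) * (sin θ * cos θ * (1 - m * sin θ ^ 2) ^ (-(3 / 2) : ℝ)))
      (m * (1 - m) * (3 / 4 * (sin θ ^ (2 * 2) * (1 - m * sin θ ^ 2) ^ (-(5 / 2) : ℝ)))
        + (1 - 2 * m) * (1 / 2 * (sin θ ^ (2 * 1) * (1 - m * sin θ ^ 2) ^ (-(3 / 2) : ℝ)))
        - 1 / 4 * (sin θ ^ (2 * 0) * (1 - m * sin θ ^ 2) ^ (-(1 / 2) : ℝ))) θ := by
    intro θ
    have h0 := one_sub_mul_sin_sq_pos hm θ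
    have h1 : HasDerivAt (fun θ : ℝ => 1 - m * sin θ ^ 2) (-(m * (2 * sin θ * cos θ))) θ := by
      simpa using (((hasDerivAt_sin θ).pow 2).const_mul m).const_sub 1
    have h2 := (((hasDerivAt_sin θ).mul (hasDerivAt_cos θ)).mul
      (h1.rpow_const (p := -(3 / 2)) (Or.inl h0.ne'))).const_mul (-(1 / 4) : ℝ)
    refine h2.congr_deriv ?_
    have e1 : (1 - m * sin θ ^ 2) ^ (-(3 / 2) : ℝ)
        = (1 - m * sin θ ^ 2) * (1 - m * sin θ ^ 2) ^ (-(5 / 2) : ℝ) := by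
      rw [← rpow_one_add' h0.le (by norm_num)]; norm_num
    have e2 : (1 - m * sin θ ^ 2) ^ (-(1 / 2) : ℝ)
        = (1 - m * sin θ ^ 2) ^ 2 * (1 - m * sin θ ^ 2) ^ (-(5 / 2) : ℝ) := by
      rw [← rpow_natCast (1 - m * sin θ ^ 2) 2, ← rpow_add h0]; norm_num
    rw [show (-(3 / 2) - 1 : ℝ) = -(5 / 2) by norm_num, Pi.mul_apply, e1, e2]
    have hc : cos θ ^ 2 = 1 - sin θ ^ 2 := cos_sq' θ
    linear_combination (1 - m * sin θ ^ 2) ^ (-(5 / 2) : ℝ) * (-(1 / 4) * (1 - m * sin θ ^ 2)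
      - 3 / 4 * m * sin θ ^ 2) * hc
  have c := fun (j : ℕ) (a : ℝ) => continuous_ellipticMoment_integrand j a hm
  have i := fun (j : ℕ) (a : ℝ) => (c j a).intervalIntegrable (μ := volume) 0 (π / 2)
  have hint := intervalIntegral.integral_eq_sub_of_hasDerivAt (a := 0) (b := π / 2)
    (fun θ _ => hd θ) (((((i 2 (5 / 2)).const_mul _).const_mul _).add
      (((i 1 (3 / 2)).const_mul _).const_mul _)).sub ((i 0 (1 / 2)).const_mul _))
  rw [intervalIntegral.integral_sub ((((i 2 (5 / 2)).const_mul _).const_mul _).add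
      (((i 1 (3 / 2)).const_mul _).const_mul _)) ((i 0 (1 / 2)).const_mul _),
    intervalIntegral.integral_add (((i 2 (5 / 2)).const_mul _).const_mul _)
      (((i 1 (3 / 2)).const_mul _).const_mul _)] at hint
  simp only [intervalIntegral.integral_const_mul] at hint
  simp only [cos_pi_div_two, sin_zero, mul_zero, zero_mul, sub_zero] at hint
  simp only [ellipticMoment]
  linarith


theorem ellipticMoment_zero_half {m : ℝ} (hm : m < 1) :
    ellipticMoment 0 (1 / 2) m = ∫ θ in (0 : ℝ)..(π / 2), 1 / √(1 - m * sin θ ^ 2) := by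
  refine intervalIntegral.integral_congr fun θ _ => ?_
  simp [rpow_neg (one_sub_mul_sin_sq_pos hm θ).le, sqrt_eq_rpow]

theorem image_sin_Ioo : sin '' Ioo 0 (π / 2) = Ioo 0 1 := by
  ext x
  constructor
  · rintro ⟨θ, hθ, rfl⟩
    refine ⟨sin_pos_of_pos_of_lt_pi hθ.1 (by linarith [hθ.2, pi_pos]), ?_⟩
    rw [← sin_pi_div_two]
    exact sin_lt_sin_of_lt_of_le_pi_div_two (by linarith [hθ.1, pi_pos]) le_rfl hθ.2
  · intro hx
    exact ⟨arcsin x, ⟨arcsin_pos.2 hx.1, arcsin_lt_pi_div_two.2 hx.2⟩,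
      sin_arcsin (by linarith [hx.1]) hx.2.le⟩

/-- The substitution `x = sin θ` in the integral defining `K`. -/
theorem ellipticK_eq_ellipticMoment {r : ℝ} (hr : r ^ 2 < 1) :
    ellipticK r = ellipticMoment 0 (1 / 2) (r ^ 2) := by
  have hinj : InjOn sin (Ioo 0 (π / 2)) :=
    injOn_sin.mono (Ioo_subset_Icc_self.trans (Icc_subset_Icc_left (by linarith [pi_pos])))
  rw [ellipticMoment_zero_half hr, ellipticK, intervalIntegral.integral_of_le zero_le_one,
    intervalIntegral.integral_of_le (by positivity), integral_Ioc_eq_integral_Ioo,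
    integral_Ioc_eq_integral_Ioo, ← image_sin_Ioo,
    integral_image_eq_integral_abs_deriv_smul (f' := cos) measurableSet_Ioo
      (fun θ _ => (hasDerivAt_sin θ).hasDerivWithinAt) hinj]
  refine setIntegral_congr_fun measurableSet_Ioo fun θ hθ => ?_
  have hc : 0 < cos θ := cos_pos_of_mem_Ioo ⟨by linarith [hθ.1, pi_pos], hθ.2⟩
  have h0 := one_sub_mul_sin_sq_pos hr θ
  simp only [smul_eq_mul]
  rw [← cos_sq' θ, sqrt_mul (sq_nonneg _), sqrt_sq hc.le, abs_of_pos hc]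
  have := sqrt_pos.2 h0
  field_simp

/-! ### The lemniscatic value -/

theorem Gamma_quarter_sq_div :
    Gamma (1 / 4) ^ 2 / √π
      = ∫ x in Ioo (0 : ℝ) 1, x ^ (-(3 / 4) : ℝ) * (1 - x) ^ (-(3 / 4) : ℝ) := by
  have h1 := ProbabilityTheory.beta_eq_betaIntegralReal (1 / 4) (1 / 4) (by norm_num) (by norm_num)
  have h2 : Complex.betaIntegral ((1 / 4 : ℝ) : ℂ) ((1 / 4 : ℝ) : ℂ)
      = ((∫ x in (0 : ℝ)..1, x ^ (-(3 / 4) : ℝ) * (1 - x) ^ (-(3 / 4) : ℝ) : ℝ) : ℂ) := by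
    rw [Complex.betaIntegral, ← intervalIntegral.integral_ofReal]
    refine intervalIntegral.integral_congr fun x hx => ?_
    rw [uIcc_of_le zero_le_one] at hx
    simp only [Complex.ofReal_mul]
    rw [Complex.ofReal_cpow hx.1, Complex.ofReal_cpow (sub_nonneg.2 hx.2)]
    push_cast
    norm_num
  rw [h2, Complex.ofReal_re, intervalIntegral.integral_of_le zero_le_one,
    integral_Ioc_eq_integral_Ioo] at h1
  rw [← h1, ProbabilityTheory.beta, show (1 / 4 + 1 / 4 : ℝ) = 1 / 2 by norm_num,
    Gamma_one_half_eq, sq]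

theorem hasDerivAt_one_add_cos_sq_div (θ : ℝ) :
    HasDerivAt (fun θ : ℝ => (1 + cos θ) ^ 2 / (2 * (1 + cos θ ^ 2)))
      (-(sin θ ^ 3 / (1 + cos θ ^ 2) ^ 2)) θ := by
  have hc := hasDerivAt_cos θ
  have h0 : (2 * (1 + cos θ ^ 2)) ≠ 0 := by positivity
  have h1 : (1 + cos θ ^ 2) ≠ 0 := by positivity
  refine (((hc.const_add 1).pow 2).div (((hc.pow 2).const_add 1).const_mul 2) h0).congr_deriv ?_
  have hs : sin θ ^ 3 = sin θ * (1 - cos θ ^ 2) := by rw [← sin_sq]; ring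
  rw [hs]
  simp
  field_simp
  ring

/-- The substitution `x = (1 + cos θ)² / (2 (1 + cos² θ))` turns the Beta integral `B(1/4, 1/4)`
into `4 K(1/√2)`, by way of `x (1 - x) = (sin²θ / (2 (1 + cos²θ)))²`. -/
theorem integral_beta_quarter :
    ∫ x in Ioo (0 : ℝ) 1, x ^ (-(3 / 4) : ℝ) * (1 - x) ^ (-(3 / 4) : ℝ)
      = ∫ θ in (0 : ℝ)..π, 2 * (1 / √(1 - 1 / 2 * sin θ ^ 2)) := by
  set f : ℝ → ℝ := fun θ : ℝ => (1 + cos θ) ^ 2 / (2 * (1 + cos θ ^ 2)) with hf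
  have hcont : Continuous f := continuous_iff_continuousAt.2 fun θ =>
    (hasDerivAt_one_add_cos_sq_div θ).continuousAt
  have hanti : StrictAntiOn f (Icc 0 π) := by
    refine strictAntiOn_of_deriv_neg (convex_Icc _ _) hcont.continuousOn fun θ hθ => ?_
    rw [interior_Icc] at hθ
    rw [(hasDerivAt_one_add_cos_sq_div θ).deriv]
    have := sin_pos_of_mem_Ioo hθ
    have : 0 < sin θ ^ 3 / (1 + cos θ ^ 2) ^ 2 := by positivity
    linarith
  have f0 : f 0 = 1 := by simp [hf]; norm_num
  have fpi : f π = 0 := by simp [hf]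
  have himg : f '' Ioo 0 π = Ioo 0 1 := by
    apply Subset.antisymm
    · rintro _ ⟨θ, hθ, rfl⟩
      constructor
      · rw [← fpi]
        exact hanti (Ioo_subset_Icc_self hθ) (right_mem_Icc.2 pi_pos.le) hθ.2
      · rw [← f0]
        exact hanti (left_mem_Icc.2 pi_pos.le) (Ioo_subset_Icc_self hθ) hθ.1
    · have := intermediate_value_Ioo' pi_pos.le hcont.continuousOn
      rwa [f0, fpi] at this
  rw [← himg, integral_image_eq_integral_abs_deriv_smul measurableSet_Ioo
      (fun θ _ => (hasDerivAt_one_add_cos_sq_div θ).hasDerivWithinAt)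
      (hanti.injOn.mono Ioo_subset_Icc_self),
    intervalIntegral.integral_of_le pi_pos.le, integral_Ioc_eq_integral_Ioo]
  refine setIntegral_congr_fun measurableSet_Ioo fun θ hθ => ?_
  have hs : 0 < sin θ := sin_pos_of_mem_Ioo hθ
  have hfm : f θ ∈ Ioo (0 : ℝ) 1 := himg ▸ mem_image_of_mem f hθ
  set D : ℝ := 1 + cos θ ^ 2 with hD
  have hD0 : 0 < D := by positivity
  have hx : f θ * (1 - f θ) = (sin θ ^ 2 / (2 * D)) ^ 2 := by
    rw [sin_sq, hf]
    simp only [← hD]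
    field_simp
    rw [hD]
    ring
  have hs2 : 1 - 1 / 2 * sin θ ^ 2 = D / 2 := by rw [sin_sq, hD]; ring
  have hq : ∀ y : ℝ, 0 < y → (y ^ 2) ^ (-(3 / 4) : ℝ) = (√y ^ 3)⁻¹ := by
    intro y hy
    rw [← rpow_natCast y 2, ← rpow_mul hy.le, sqrt_eq_rpow, ← rpow_natCast (y ^ (1 / 2 : ℝ)) 3,
      ← rpow_mul hy.le, ← rpow_neg hy.le]
    norm_num
  simp only [smul_eq_mul]
  rw [← mul_rpow hfm.1.le (sub_nonneg.2 hfm.2.le), hx, hq _ (by positivity), hs2, abs_neg,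
    abs_of_pos (by positivity), sqrt_div (sq_nonneg _), sqrt_sq hs.le, sqrt_div hD0.le,
    sqrt_mul zero_le_two]
  have e1 : √D ^ 2 = D := sq_sqrt hD0.le
  have e2 : √(2 : ℝ) ^ 2 = 2 := sq_sqrt zero_le_two
  have p1 : 0 < √D := sqrt_pos.2 hD0
  have p2 : 0 < √(2 : ℝ) := sqrt_pos.2 zero_lt_two
  rw [show D ^ 2 = √D ^ 4 by rw [show √D ^ 4 = (√D ^ 2) ^ 2 by ring, e1]]
  field_simp
  rw [e2]

/-- The value `K(1/√2) = Γ(1/4)² / (4 √π)`. -/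
theorem ellipticMoment_zero_half_half :
    ellipticMoment 0 (1 / 2) (1 / 2) = Gamma (1 / 4) ^ 2 / (4 * √π) := by
  have hcont : Continuous fun θ : ℝ => 1 / √(1 - 1 / 2 * sin θ ^ 2) := by
    refine continuous_const.div (by fun_prop) fun θ => ?_
    exact (sqrt_pos.2 (one_sub_mul_sin_sq_pos (by norm_num) θ)).ne'
  have h := Gamma_quarter_sq_div
  rw [integral_beta_quarter, intervalIntegral.integral_const_mul,
    ← intervalIntegral.integral_add_adjacent_intervals (b := π / 2)
      (hcont.intervalIntegrable _ _) (hcont.intervalIntegrable _ _)] at h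
  have h2 : ∫ θ in (π / 2)..π, 1 / √(1 - 1 / 2 * sin θ ^ 2)
      = ∫ θ in (0 : ℝ)..(π / 2), 1 / √(1 - 1 / 2 * sin θ ^ 2) := by
    have := intervalIntegral.integral_comp_sub_left (a := 0) (b := π / 2)
      (fun θ : ℝ => 1 / √(1 - 1 / 2 * sin θ ^ 2)) π
    simp only [sin_pi_sub, sub_zero, show π - π / 2 = π / 2 by ring] at this
    exact this.symm
  rw [h2, ← ellipticMoment_zero_half (by norm_num)] at h
  rw [mul_comm 4 (√π), ← div_div, h]
  ring

/-! ### The logarithmic variable -/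

/-- The complete elliptic integral `K` as a function `u` of the logarithmic variable `t`: the
parameter is `m = eᵗ / (1 + eᵗ)`. The complementary integral is `u (-t)`. -/
noncomputable def logK (t : ℝ) : ℝ := ellipticMoment 0 (1 / 2) (sigmoid t)

/-- The derivative of `logK`. -/
noncomputable def logK' (t : ℝ) : ℝ :=
  sigmoid t * (1 - sigmoid t) * (1 / 2 * ellipticMoment 1 (3 / 2) (sigmoid t))

/-- The potential `q` in the equation `u'' = q u` satisfied by `logK`; it equals
`1 / (16 cosh² (t / 2))`. -/
noncomputable def potential (t : ℝ) : ℝ := sigmoid t * (1 - sigmoid t) / 4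

theorem potential_pos (t : ℝ) : 0 < potential t := by
  have := sigmoid_pos t
  have := sub_pos.2 (sigmoid_lt_one t)
  unfold potential
  positivity

theorem potential_neg (t : ℝ) : potential (-t) = potential t := by
  simp only [potential, sigmoid_neg]
  ring

theorem logK_pos (t : ℝ) : 0 < logK t := ellipticMoment_pos _ _ (sigmoid_lt_one t)

theorem hasDerivAt_logK (t : ℝ) : HasDerivAt logK (logK' t) t := by
  have h := (hasDerivAt_ellipticMoment 0 (a := 1 / 2) (by norm_num) (sigmoid_lt_one t)).comp t
    (hasDerivAt_sigmoid t)
  refine h.congr_deriv ?_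
  rw [logK', zero_add, show (1 / 2 + 1 : ℝ) = 3 / 2 by norm_num]
  ring

/-- In the logarithmic variable, Legendre's equation becomes `u'' = q u`. -/
theorem hasDerivAt_logK' (t : ℝ) : HasDerivAt logK' (potential t * logK t) t := by
  have hs := hasDerivAt_sigmoid t
  have h := (hs.mul (hs.const_sub 1)).mul
    (((hasDerivAt_ellipticMoment 1 (a := 3 / 2) (by norm_num) (sigmoid_lt_one t)).comp t
      hs).const_mul (1 / 2))
  refine h.congr_deriv ?_
  have hl := ellipticMoment_legendre (sigmoid_lt_one t)
  simp only [Pi.mul_apply, Function.comp_apply, potential, logK]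
  rw [show (1 + 1 : ℕ) = 2 from rfl, show (3 / 2 + 1 : ℝ) = 5 / 2 by norm_num]
  linear_combination (sigmoid t * (1 - sigmoid t)) * hl

theorem hasDerivAt_logK_neg (t : ℝ) : HasDerivAt (fun t => logK (-t)) (-logK' (-t)) t := by
  exact ((hasDerivAt_logK (-t)).comp t (hasDerivAt_neg t)).congr_deriv (by ring)

theorem hasDerivAt_logK'_neg (t : ℝ) :
    HasDerivAt (fun t => logK' (-t)) (-(potential t * logK (-t))) t := by
  exact ((hasDerivAt_logK' (-t)).comp t (hasDerivAt_neg t)).congr_deriv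
    (by rw [potential_neg]; ring)

theorem ellipticK_one_div_sqrt (t : ℝ) : ellipticK (1 / √(1 + exp t)) = logK (-t) := by
  have h : (1 / √(1 + exp t)) ^ 2 = sigmoid (-t) := by
    rw [div_pow, sq_sqrt (by positivity), sigmoid_def, neg_neg]
    simp
  rw [ellipticK_eq_ellipticMoment (h ▸ sigmoid_lt_one _), h, logK]

theorem hFun_eq (t : ℝ) : hFun t = π / (8 * (logK t * logK (-t))) := by
  rw [hFun, ellipticK_one_div_sqrt, ellipticK_one_div_sqrt, neg_neg]
  ring_nf

theorem HFun_eq (t : ℝ) : HFun t = 8 / π * (logK t * logK (-t)) := by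
  rw [HFun, hFun_eq, one_div_div]
  ring

theorem logK_zero : logK 0 = Gamma (1 / 4) ^ 2 / (4 * √π) := by
  rw [logK, sigmoid_zero, show (2⁻¹ : ℝ) = 1 / 2 by norm_num, ellipticMoment_zero_half_half]

theorem HFun_zero : HFun 0 = 2 * hempelC := by
  rw [HFun_eq, neg_zero, logK_zero, hempelC]
  have h : √π ^ 2 = π := sq_sqrt pi_pos.le
  rw [div_mul_div_comm, show 4 * √π * (4 * √π) = 16 * π by linear_combination 16 * h]
  field_simp
  ring

/-! ### Asymptotics of `K` at the two ends -/

theorem integral_sin_sq_quarter : ∫ θ in (0 : ℝ)..(π / 2), sin θ ^ 2 = π / 4 := by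
  rw [integral_sin_sq]
  simp
  ring

theorem one_add_half_mul_le {x : ℝ} (hx : x < 1) (hx0 : 0 ≤ x) : 1 + x / 2 ≤ 1 / √(1 - x) := by
  have h : 0 < 1 - x := sub_pos.2 hx
  have h1 := sqrt_pos.2 h
  have h2 : √(1 - x) ^ 2 = 1 - x := sq_sqrt h.le
  rw [le_div_iff₀ h1]
  nlinarith [sq_nonneg (√(1 - x) - 1)]

theorem continuous_one_div_sqrt {m : ℝ} (hm : m < 1) :
    Continuous fun θ : ℝ => 1 / √(1 - m * sin θ ^ 2) :=
  continuous_const.div (by fun_prop) fun θ => (sqrt_pos.2 (one_sub_mul_sin_sq_pos hm θ)).ne'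

theorem le_logK_neg (t : ℝ) : π / 2 * (1 + sigmoid (-t) / 4) ≤ logK (-t) := by
  set m := sigmoid (-t) with hm
  have hm1 : m < 1 := sigmoid_lt_one _
  have hm0 : 0 < m := sigmoid_pos _
  rw [logK, ← hm, ellipticMoment_zero_half hm1]
  have h : ∫ θ in (0 : ℝ)..(π / 2), (1 + m / 2 * sin θ ^ 2) = π / 2 * (1 + m / 4) := by
    rw [intervalIntegral.integral_add (by simp) (Continuous.intervalIntegrable (by fun_prop) _ _),
      intervalIntegral.integral_const_mul, integral_sin_sq_quarter]
    simp
    ring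
  rw [← h]
  refine intervalIntegral.integral_mono_on (by positivity)
    (Continuous.intervalIntegrable (by fun_prop) _ _)
    ((continuous_one_div_sqrt hm1).intervalIntegrable _ _) fun θ _ => ?_
  have := one_add_half_mul_le (x := m * sin θ ^ 2)
    (by linarith [one_sub_mul_sin_sq_pos hm1 θ]) (by positivity)
  linarith

theorem half_pi_le_logK_neg (t : ℝ) : π / 2 ≤ logK (-t) := by
  have h1 := le_logK_neg t
  have h2 := sigmoid_pos (-t)
  nlinarith [pi_pos]

theorem logK_neg_le (t : ℝ) : logK (-t) ≤ π / 2 * (1 + exp (-t)) := by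
  set m := sigmoid (-t) with hm
  have hm1 : m < 1 := sigmoid_lt_one _
  have hm0 : 0 < m := sigmoid_pos _
  have he : 1 + exp (-t) = 1 / (1 - m) := by
    rw [hm, ← sigmoid_neg, neg_neg, sigmoid_def]; simp
  rw [logK, ← hm, ellipticMoment_zero_half hm1, he]
  have h : ∫ θ in (0 : ℝ)..(π / 2), (1 / (1 - m)) = π / 2 * (1 / (1 - m)) := by simp
  rw [← h]
  refine intervalIntegral.integral_mono_on (by positivity)
    ((continuous_one_div_sqrt hm1).intervalIntegrable _ _) (by simp) fun θ _ => ?_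
  have h1 : 1 - m ≤ 1 - m * sin θ ^ 2 := by nlinarith [sin_sq_le_one θ]
  have h2 : 0 < 1 - m := sub_pos.2 hm1
  gcongr
  refine le_sqrt_of_sq_le (le_trans ?_ h1)
  nlinarith

theorem tendsto_logK_neg : Tendsto (fun t => logK (-t)) atTop (𝓝 (π / 2)) := by
  refine tendsto_of_tendsto_of_tendsto_of_le_of_le tendsto_const_nhds
    (h := fun t : ℝ => π / 2 * (1 + exp (-t))) ?_ half_pi_le_logK_neg logK_neg_le
  simpa using ((tendsto_exp_neg_atTop_nhds_zero).const_add 1).const_mul (π / 2)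

theorem tendsto_mul_exp_neg : Tendsto (fun t : ℝ => t * exp (-t)) atTop (𝓝 0) := by
  simpa using tendsto_pow_mul_exp_neg_atTop_nhds_zero 1

theorem tendsto_mul_logK_neg_sub :
    Tendsto (fun t => t * (logK (-t) - π / 2)) atTop (𝓝 0) := by
  have h2 : Tendsto (fun t : ℝ => π / 2 * (t * exp (-t))) atTop (𝓝 0) := by
    simpa using tendsto_mul_exp_neg.const_mul (π / 2)
  refine tendsto_of_tendsto_of_tendsto_of_le_of_le' tendsto_const_nhds h2 ?_ ?_
  · filter_upwards [eventually_ge_atTop 0] with t ht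
    exact mul_nonneg ht (sub_nonneg.2 (half_pi_le_logK_neg t))
  · filter_upwards [eventually_ge_atTop 0] with t ht
    nlinarith [logK_neg_le t]

/-- After the reflection `θ = π/2 - φ` the integrand of `K` is split by `1 = cos φ + (1 - cos φ)`;
the first part has an elementary antiderivative and carries the logarithmic singularity. -/
theorem logK_eq_arsinh_add (t : ℝ) :
    logK t = √(1 + exp (-t)) * arsinh (exp (t / 2))
      + ∫ φ in (0 : ℝ)..(π / 2), (1 - cos φ) / √(1 - sigmoid t * cos φ ^ 2) := by
  set σ := sigmoid t with hσ
  have h1 : σ < 1 := sigmoid_lt_one _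
  have h0 : 0 < σ := sigmoid_pos _
  have hpos : ∀ φ : ℝ, 0 < 1 - σ * cos φ ^ 2 := fun φ => by nlinarith [cos_sq_le_one φ]
  have hflip : logK t = ∫ φ in (0 : ℝ)..(π / 2), 1 / √(1 - σ * cos φ ^ 2) := by
    rw [logK, ← hσ, ellipticMoment_zero_half h1]
    have := intervalIntegral.integral_comp_sub_left (a := 0) (b := π / 2)
      (fun θ : ℝ => 1 / √(1 - σ * sin θ ^ 2)) (π / 2)
    simp only [sin_pi_div_two_sub, sub_zero, sub_self] at this
    exact this.symm
  have hσi : 1 + exp (-t) = σ⁻¹ := by rw [hσ, sigmoid_def, inv_inv]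
  have hexp : exp (t / 2) ^ 2 = σ / (1 - σ) := by
    rw [← exp_nat_mul, hσ, ← sigmoid_neg, ← sigmoid_mul_rexp_neg t, exp_neg]
    have := sigmoid_pos t
    field_simp
    norm_num
  have hd : ∀ φ : ℝ, HasDerivAt (fun φ => √(1 + exp (-t)) * arsinh (exp (t / 2) * sin φ))
      (cos φ / √(1 - σ * cos φ ^ 2)) φ := by
    intro φ
    have h := (((hasDerivAt_sin φ).const_mul (exp (t / 2))).arsinh).const_mul (√(1 + exp (-t)))
    refine h.congr_deriv ?_
    have e1 : 1 + (exp (t / 2) * sin φ) ^ 2 = (1 - σ * cos φ ^ 2) / (1 - σ) := by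
      rw [mul_pow, hexp, sin_sq]
      have := (sub_pos.2 h1).ne'
      field_simp
      ring
    have e2 : exp (t / 2) = √(σ / (1 - σ)) := by rw [← hexp, sqrt_sq (exp_pos _).le]
    rw [e1, hσi, e2, sqrt_inv, sqrt_div h0.le, sqrt_div (hpos φ).le]
    have := sqrt_pos.2 h0
    have := sqrt_pos.2 (sub_pos.2 h1)
    have := sqrt_pos.2 (hpos φ)
    simp only [smul_eq_mul]
    field_simp
  have hs : ∀ φ : ℝ, √(1 - σ * cos φ ^ 2) ≠ 0 := fun φ => (sqrt_pos.2 (hpos φ)).ne'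
  have c1 : Continuous fun φ : ℝ => cos φ / √(1 - σ * cos φ ^ 2) :=
    continuous_cos.div (by fun_prop) hs
  have c2 : Continuous fun φ : ℝ => (1 - cos φ) / √(1 - σ * cos φ ^ 2) :=
    (by fun_prop : Continuous fun φ : ℝ => 1 - cos φ).div (by fun_prop) hs
  have hA := intervalIntegral.integral_eq_sub_of_hasDerivAt (a := 0) (b := π / 2)
    (fun φ _ => hd φ) (c1.intervalIntegrable _ _)
  simp only [sin_pi_div_two, mul_one, sin_zero, mul_zero, arsinh_zero, sub_zero] at hA
  rw [← hA, ← intervalIntegral.integral_add (c1.intervalIntegrable _ _)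
    (c2.intervalIntegrable _ _), hflip]
  refine intervalIntegral.integral_congr fun φ _ => ?_
  ring

theorem tendsto_integral_one_sub_cos :
    Tendsto (fun t => ∫ φ in (0 : ℝ)..(π / 2), (1 - cos φ) / √(1 - sigmoid t * cos φ ^ 2))
      atTop (𝓝 (log 2)) := by
  have hlim : ∫ φ in (0 : ℝ)..(π / 2), sin φ / (1 + cos φ) = log 2 := by
    have hpos : ∀ φ ∈ uIcc 0 (π / 2), 0 < 1 + cos φ := by
      intro φ hφ
      rw [uIcc_of_le (by positivity)] at hφ
      have := cos_nonneg_of_mem_Icc ⟨by linarith [hφ.1, pi_pos], hφ.2⟩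
      linarith
    have h := intervalIntegral.integral_eq_sub_of_hasDerivAt (a := 0) (b := π / 2)
      (f := fun φ => -log (1 + cos φ)) (f' := fun φ => sin φ / (1 + cos φ)) ?_ ?_
    · rw [h]
      simp
      norm_num
    · intro φ hφ
      refine ((((hasDerivAt_cos φ).const_add 1).log (hpos φ hφ).ne').neg).congr_deriv ?_
      ring
    · refine ContinuousOn.intervalIntegrable ?_
      exact continuousOn_sin.div (by fun_prop) fun φ hφ => (hpos φ hφ).ne'
  rw [← hlim]
  refine intervalIntegral.tendsto_integral_filter_of_dominated_convergence (fun _ => √2) ?_ ?_ ?_ ?_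
  · refine Eventually.of_forall fun t => Measurable.aestronglyMeasurable ?_
    fun_prop
  · filter_upwards [eventually_ge_atTop 0] with t ht
    refine Eventually.of_forall fun φ hφ => ?_
    rw [uIoc_of_le (by positivity)] at hφ
    have hs : 0 < sin φ := sin_pos_of_pos_of_lt_pi hφ.1 (by linarith [hφ.2, pi_pos])
    have hc : 0 ≤ cos φ := cos_nonneg_of_mem_Icc ⟨by linarith [hφ.1, pi_pos], hφ.2⟩
    have h1 := sigmoid_le_one t
    have h2 : 1 / 2 ≤ sigmoid t := by
      have := sigmoid_le ht
      rwa [sigmoid_zero, inv_eq_one_div] at this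
    -- For `σ ≥ 1/2` the radicand is at least `sin²φ / 2`, and `1 - cos φ ≤ sin²φ`.
    have h3 : (sin φ / √2) ^ 2 ≤ 1 - sigmoid t * cos φ ^ 2 := by
      rw [div_pow, sq_sqrt zero_le_two]
      nlinarith [sin_sq_add_cos_sq φ, sq_nonneg (cos φ), sq_nonneg (sin φ)]
    have h4 : sin φ / √2 ≤ √(1 - sigmoid t * cos φ ^ 2) := le_sqrt_of_sq_le h3
    have h5 : 1 - cos φ ≤ sin φ ^ 2 := by nlinarith [sin_sq_add_cos_sq φ, cos_le_one φ]
    have h6 : 0 < √(2 : ℝ) := sqrt_pos.2 zero_lt_two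
    have h7 : 0 < sin φ / √2 := by positivity
    rw [norm_of_nonneg (div_nonneg (by linarith [cos_le_one φ]) (sqrt_nonneg _)),
      div_le_iff₀ (h7.trans_le h4)]
    calc 1 - cos φ ≤ sin φ := by nlinarith [sin_le_one φ]
      _ = √2 * (sin φ / √2) := by field_simp
      _ ≤ _ := by gcongr
  · simp
  · refine Eventually.of_forall fun φ hφ => ?_
    rw [uIoc_of_le (by positivity)] at hφ
    have hs : 0 < sin φ := sin_pos_of_pos_of_lt_pi hφ.1 (by linarith [hφ.2, pi_pos])
    have hc : 0 ≤ cos φ := cos_nonneg_of_mem_Icc ⟨by linarith [hφ.1, pi_pos], hφ.2⟩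
    have e : sin φ / (1 + cos φ) = (1 - cos φ) / √(1 - 1 * cos φ ^ 2) := by
      rw [one_mul, ← sin_sq, sqrt_sq hs.le, div_eq_div_iff (by positivity) hs.ne']
      nlinarith [sin_sq_add_cos_sq φ]
    rw [e]
    refine tendsto_const_nhds.div ?_ ?_
    · exact ((tendsto_sigmoid_atTop.mul_const _).const_sub 1).sqrt
    · rw [one_mul, ← sin_sq, sqrt_sq hs.le]
      exact hs.ne'

/-- `K(r) = log (4 / r') + o(1)` as `r → 1`, in the logarithmic variable. -/
theorem tendsto_logK_sub : Tendsto (fun t => logK t - t / 2) atTop (𝓝 (2 * log 2)) := by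
  have hexp := tendsto_exp_neg_atTop_nhds_zero
  have hsq : Tendsto (fun t : ℝ => √(1 + exp (-t))) atTop (𝓝 1) := by
    simpa using (hexp.const_add 1).sqrt
  have hlog : Tendsto (fun t : ℝ => log (1 + √(1 + exp (-t)))) atTop (𝓝 (log 2)) := by
    have := (hsq.const_add 1).log (by norm_num)
    rwa [one_add_one_eq_two] at this
  have hzero : Tendsto (fun t : ℝ => (√(1 + exp (-t)) - 1) * t) atTop (𝓝 0) := by
    refine tendsto_of_tendsto_of_tendsto_of_le_of_le' tendsto_const_nhds tendsto_mul_exp_neg ?_ ?_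
    · filter_upwards [eventually_ge_atTop 0] with t ht
      refine mul_nonneg (sub_nonneg.2 (one_le_sqrt.2 ?_)) ht
      linarith [exp_pos (-t)]
    · filter_upwards [eventually_ge_atTop 0] with t ht
      have : √(1 + exp (-t)) ≤ 1 + exp (-t) := by
        rw [sqrt_le_left (by positivity)]
        nlinarith [exp_pos (-t)]
      nlinarith
  have harsinh : ∀ t : ℝ, arsinh (exp (t / 2)) = t / 2 + log (1 + √(1 + exp (-t))) := by
    intro t
    have e : 1 + exp (t / 2) ^ 2 = exp (t / 2) ^ 2 * (1 + exp (-t)) := by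
      rw [← exp_nat_mul, mul_add, ← exp_add]
      ring_nf
      simp [add_comm]
    rw [arsinh, e, sqrt_mul (sq_nonneg _), sqrt_sq (exp_pos _).le,
      show exp (t / 2) + exp (t / 2) * √(1 + exp (-t)) = exp (t / 2) * (1 + √(1 + exp (-t))) by
        ring, log_mul (exp_pos _).ne' (by positivity), log_exp]
  have := ((hzero.const_mul (1 / 2)).add (hsq.mul hlog)).add tendsto_integral_one_sub_cos
  rw [show 1 / 2 * 0 + 1 * log 2 + log 2 = 2 * log 2 by ring] at this
  refine this.congr fun t => ?_
  rw [logK_eq_arsinh_add, harsinh]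
  ring

/-! ### Limits of derivatives -/

/-- If `f` is differentiable with monotone derivative and `f - a t` converges at `+∞`, then
`f'` tends to `a`: the derivative lies between the difference quotients over steps of length one. -/
theorem tendsto_deriv_of_monotone {f f' : ℝ → ℝ} {a c : ℝ} (hf : ∀ t, HasDerivAt f (f' t) t)
    (hm : Monotone f') (hc : Tendsto (fun t => f t - a * t) atTop (𝓝 c)) :
    Tendsto f' atTop (𝓝 a) := by
  have hmv : ∀ t : ℝ, ∃ ξ ∈ Ioo t (t + 1), f' ξ = f (t + 1) - f t := by
    intro t
    obtain ⟨ξ, h1, h2⟩ := exists_hasDerivAt_eq_slope f f' (lt_add_one t)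
      (fun x _ => (hf x).continuousAt.continuousWithinAt) (fun x _ => hf x)
    exact ⟨ξ, h1, by rw [h2]; simp⟩
  have hup : Tendsto (fun t => f (t + 1) - f t) atTop (𝓝 a) := by
    have h := ((hc.comp (tendsto_atTop_add_const_right _ 1 tendsto_id)).sub hc).add_const a
    rw [sub_self, zero_add] at h
    refine h.congr fun t => ?_
    simp only [Function.comp_apply, id]
    ring
  refine tendsto_of_tendsto_of_tendsto_of_le_of_le
    (hup.comp (tendsto_atTop_add_const_right _ (-1) tendsto_id)) hup (fun t => ?_) (fun t => ?_)
  · obtain ⟨ξ, h1, h2⟩ := hmv (t + -1)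
    simp only [Function.comp_apply, id]
    rw [← h2]
    exact hm (by linarith [h1.2])
  · obtain ⟨ξ, h1, h2⟩ := hmv t
    simp only
    rw [← h2]
    exact hm h1.1.le

theorem monotone_logK' : Monotone logK' :=
  monotone_of_deriv_nonneg (fun t => (hasDerivAt_logK' t).differentiableAt) fun t => by
    rw [(hasDerivAt_logK' t).deriv]
    exact (mul_pos (potential_pos t) (logK_pos t)).le

theorem tendsto_logK' : Tendsto logK' atTop (𝓝 (1 / 2)) := by
  refine tendsto_deriv_of_monotone hasDerivAt_logK monotone_logK' (c := 2 * log 2) ?_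
  refine tendsto_logK_sub.congr fun t => ?_
  ring

theorem tendsto_logK'_neg : Tendsto (fun t => logK' (-t)) atTop (𝓝 0) := by
  have h := tendsto_deriv_of_monotone (a := 0) (c := π / 2) hasDerivAt_logK_neg
    (fun s t hst => neg_le_neg (monotone_logK' (neg_le_neg hst))) (by simpa using tendsto_logK_neg)
  simpa using h.neg

/-! ### Convexity of `H` -/

/-- The derivative of `HFun`. -/
noncomputable def HFun' (t : ℝ) : ℝ := 8 / π * (logK' t * logK (-t) - logK t * logK' (-t))

/-- Half the second derivative of `t ↦ logK t * logK (-t)`. -/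
noncomputable def convexityForm (t : ℝ) : ℝ :=
  potential t * (logK t * logK (-t)) - logK' t * logK' (-t)

theorem hasDerivAt_logK_mul (t : ℝ) : HasDerivAt (fun t => logK t * logK (-t))
    (logK' t * logK (-t) - logK t * logK' (-t)) t :=
  ((hasDerivAt_logK t).mul (hasDerivAt_logK_neg t)).congr_deriv (by ring)

theorem hasDerivAt_HFun (t : ℝ) : HasDerivAt HFun (HFun' t) t := by
  rw [show HFun = fun t => 8 / π * (logK t * logK (-t)) from funext HFun_eq]
  exact (hasDerivAt_logK_mul t).const_mul _

theorem hasDerivAt_HFun' (t : ℝ) : HasDerivAt HFun' (16 / π * convexityForm t) t := by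
  have h := ((((hasDerivAt_logK' t).mul (hasDerivAt_logK_neg t)).sub
    ((hasDerivAt_logK t).mul (hasDerivAt_logK'_neg t))).const_mul (8 / π))
  refine h.congr_deriv ?_
  rw [convexityForm]
  ring

theorem hasDerivAt_potential (t : ℝ) :
    HasDerivAt potential (potential t * (1 - 2 * sigmoid t)) t := by
  have h := hasDerivAt_sigmoid t
  refine ((h.mul (h.const_sub 1)).div_const 4).congr_deriv ?_
  rw [potential]
  ring

theorem hasDerivAt_convexityForm (t : ℝ) :
    HasDerivAt convexityForm (potential t * ((1 - 2 * sigmoid t) * (logK t * logK (-t))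
      + 2 * (logK' t * logK (-t) - logK t * logK' (-t)))) t := by
  refine (((hasDerivAt_potential t).mul (hasDerivAt_logK_mul t)).sub
    ((hasDerivAt_logK' t).mul (hasDerivAt_logK'_neg t))).congr_deriv ?_
  ring

/-- The logarithmic derivative of `q (logK t · logK (-t))²` is negative for `t > 0`. It vanishes at
`0`, and its derivative is negative because each `w = u' / u` satisfies the Riccati equation
`w' = q - w²`, while `(2 σ - 1)' = 8 q`. -/
theorem two_mul_logDeriv_lt {t : ℝ} (ht : 0 < t) :
    2 * (logK' t / logK t - logK' (-t) / logK (-t)) < 2 * sigmoid t - 1 := by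
  have hd : ∀ s : ℝ, HasDerivAt
      (fun s => 2 * sigmoid s - 1 - 2 * (logK' s / logK s - logK' (-s) / logK (-s)))
      (4 * potential s + 2 * (logK' s / logK s) ^ 2 + 2 * (logK' (-s) / logK (-s)) ^ 2) s := by
    intro s
    have p1 := (logK_pos s).ne'
    have p2 := (logK_pos (-s)).ne'
    have h1 := (hasDerivAt_logK' s).div (hasDerivAt_logK s) p1
    have h2 := (hasDerivAt_logK'_neg s).div (hasDerivAt_logK_neg s) p2
    refine ((((hasDerivAt_sigmoid s).const_mul 2).sub_const 1).sub
      ((h1.sub h2).const_mul 2)).congr_deriv ?_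
    rw [show sigmoid s * (1 - sigmoid s) = 4 * potential s by rw [potential]; ring]
    field_simp
    ring
  have hmono := strictMono_of_deriv_pos
    (f := fun s => 2 * sigmoid s - 1 - 2 * (logK' s / logK s - logK' (-s) / logK (-s)))
    (fun s => by rw [(hd s).deriv]; have := potential_pos s; positivity)
  have h := hmono ht
  simp only [neg_zero, sub_self, mul_zero, sigmoid_zero] at h
  norm_num at h
  linarith

theorem strictAntiOn_convexityForm : StrictAntiOn convexityForm (Ici 0) := by
  refine strictAntiOn_of_deriv_neg (convex_Ici 0)
    (fun t _ => (hasDerivAt_convexityForm t).continuousAt.continuousWithinAt) fun t ht => ?_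
  rw [interior_Ici] at ht
  rw [(hasDerivAt_convexityForm t).deriv]
  refine mul_neg_of_pos_of_neg (potential_pos t) ?_
  have h := two_mul_logDeriv_lt ht
  have p1 := logK_pos t
  have p2 := logK_pos (-t)
  have e : (1 - 2 * sigmoid t) * (logK t * logK (-t))
      + 2 * (logK' t * logK (-t) - logK t * logK' (-t))
      = (logK t * logK (-t)) * (2 * (logK' t / logK t - logK' (-t) / logK (-t))
        - (2 * sigmoid t - 1)) := by
    field_simp
    ring
  rw [e]
  exact mul_neg_of_pos_of_neg (mul_pos p1 p2) (by linarith)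

theorem tendsto_potential_mul : Tendsto (fun t => potential t * t) atTop (𝓝 0) := by
  refine tendsto_of_tendsto_of_tendsto_of_le_of_le' tendsto_const_nhds tendsto_mul_exp_neg ?_ ?_
  · filter_upwards [eventually_ge_atTop 0] with t ht
    exact mul_nonneg (potential_pos t).le ht
  · filter_upwards [eventually_ge_atTop 0] with t ht
    rw [mul_comm]
    gcongr
    rw [potential, ← sigmoid_neg, ← sigmoid_mul_rexp_neg]
    nlinarith [sigmoid_pos t, sigmoid_lt_one t, exp_pos (-t),
      mul_pos (sigmoid_pos t) (exp_pos (-t)),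
      mul_pos (sub_pos.2 (sigmoid_lt_one t)) (exp_pos (-t)),
      mul_pos (mul_pos (sigmoid_pos t) (exp_pos (-t))) (sub_pos.2 (sigmoid_lt_one t))]

theorem tendsto_potential : Tendsto potential atTop (𝓝 0) := by
  have := (tendsto_sigmoid_atTop.mul (tendsto_sigmoid_atTop.const_sub 1)).div_const 4
  rw [sub_self, mul_zero, zero_div] at this
  exact this

theorem tendsto_convexityForm : Tendsto convexityForm atTop (𝓝 0) := by
  have h1 : Tendsto (fun t => potential t * logK t) atTop (𝓝 0) := by
    have := (tendsto_potential.mul tendsto_logK_sub).add (tendsto_potential_mul.const_mul (1 / 2))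
    rw [zero_mul, mul_zero, zero_add] at this
    refine this.congr fun t => ?_
    ring
  have h2 := (h1.mul tendsto_logK_neg).sub (tendsto_logK'.mul tendsto_logK'_neg)
  rw [zero_mul, mul_zero, sub_zero] at h2
  refine h2.congr fun t => ?_
  rw [convexityForm]
  ring

theorem convexityForm_neg (t : ℝ) : convexityForm (-t) = convexityForm t := by
  rw [convexityForm, convexityForm, potential_neg, neg_neg]
  ring

theorem convexityForm_pos (t : ℝ) : 0 < convexityForm t := by
  have key : ∀ s : ℝ, 0 ≤ s → 0 < convexityForm s := by
    intro s hs
    have h1 : convexityForm (s + 1) < convexityForm s :=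
      strictAntiOn_convexityForm hs (by simp; linarith) (by linarith)
    have h2 : 0 ≤ convexityForm (s + 1) := by
      refine le_of_tendsto tendsto_convexityForm ?_
      filter_upwards [eventually_ge_atTop (s + 1)] with x hx
      exact strictAntiOn_convexityForm.antitoneOn (by simp; linarith) (by simp; linarith) hx
    linarith
  rcases le_total 0 t with h | h
  · exact key t h
  · rw [← convexityForm_neg]
    exact key (-t) (by linarith)

theorem deriv_HFun : deriv HFun = HFun' := funext fun t => (hasDerivAt_HFun t).deriv

theorem deriv_deriv_HFun_pos (t : ℝ) : 0 < deriv (deriv HFun) t := by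
  rw [deriv_HFun, (hasDerivAt_HFun' t).deriv]
  have := convexityForm_pos t
  positivity

theorem strictMono_HFun' : StrictMono HFun' :=
  strictMono_of_deriv_pos fun t => by rw [← deriv_HFun]; exact deriv_deriv_HFun_pos t

theorem HFun_even (t : ℝ) : HFun (-t) = HFun t := by
  rw [HFun_eq, HFun_eq, neg_neg]
  ring

theorem HFun'_neg (t : ℝ) : HFun' (-t) = -HFun' t := by
  rw [HFun', HFun', neg_neg]
  ring

/-! ### Asymptotics of `H` and the two-sided estimate -/

/-- Since `u = t/2 + log 4 + o(1)` and `t (v - π/2) → 0` for `v t = u (-t)`, the product `H`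
is asymptotic to `2 (t + log 16)`. -/
theorem tendsto_HFun_sub : Tendsto (fun t => HFun t - 2 * t) atTop (𝓝 (2 * log 16)) := by
  have h := ((tendsto_logK_sub.mul tendsto_logK_neg).add
    (tendsto_mul_logK_neg_sub.const_mul (1 / 2))).const_mul (8 / π)
  have e : 8 / π * (2 * log 2 * (π / 2) + 1 / 2 * 0) = 2 * log 16 := by
    rw [show (16 : ℝ) = 2 ^ 4 by norm_num, log_pow]
    field_simp
    push_cast
    ring
  rw [e] at h
  refine h.congr fun t => ?_
  rw [HFun_eq]
  field_simp
  ring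

theorem tendsto_HFun' : Tendsto HFun' atTop (𝓝 2) :=
  tendsto_deriv_of_monotone hasDerivAt_HFun strictMono_HFun'.monotone tendsto_HFun_sub

theorem HFun'_lt_two (t : ℝ) : HFun' t < 2 :=
  (strictMono_HFun' (lt_add_one t)).trans_le
    (strictMono_HFun'.monotone.ge_of_tendsto tendsto_HFun' _)

theorem HFun'_zero : HFun' 0 = 0 := by
  have := HFun'_neg 0
  rw [neg_zero] at this
  linarith

theorem strictAnti_HFun_sub : StrictAnti fun t => HFun t - 2 * t := by
  have hd : ∀ t, HasDerivAt (fun t => HFun t - 2 * t) (HFun' t - 2) t := fun t =>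
    ((hasDerivAt_HFun t).sub ((hasDerivAt_id t).const_mul 2)).congr_deriv (by ring)
  refine strictAnti_of_deriv_neg fun t => ?_
  rw [(hd t).deriv]
  linarith [HFun'_lt_two t]

theorem two_mul_add_log_lt_HFun (t : ℝ) : 2 * (t + log 16) < HFun t := by
  have h1 : HFun (t + 1) - 2 * (t + 1) < HFun t - 2 * t := strictAnti_HFun_sub (lt_add_one t)
  have h2 := strictAnti_HFun_sub.antitone.le_of_tendsto tendsto_HFun_sub (t + 1)
  linarith

theorem two_mul_abs_add_log_lt_HFun (t : ℝ) : 2 * (|t| + log 16) < HFun t := by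
  rcases abs_choice t with h | h <;> rw [h]
  · exact two_mul_add_log_lt_HFun t
  · rw [← HFun_even]
    exact two_mul_add_log_lt_HFun (-t)

theorem HFun_lt_of_ne {t : ℝ} (ht : t ≠ 0) : HFun t < 2 * (|t| + hempelC) := by
  have h1 : HFun |t| - 2 * |t| < HFun 0 - 2 * 0 := strictAnti_HFun_sub (abs_pos.2 ht)
  rw [HFun_zero] at h1
  have h2 : HFun |t| = HFun t := by
    rcases abs_choice t with h | h <;> rw [h]
    exact HFun_even t
  linarith

theorem HFun_pos (t : ℝ) : 0 < HFun t := by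
  rw [HFun_eq]
  have := logK_pos t
  have := logK_pos (-t)
  positivity

/-! ### Images of `H`, `H'` and `t h(t)` -/

theorem strictMonoOn_HFun : StrictMonoOn HFun (Ici 0) := by
  refine strictMonoOn_of_deriv_pos (convex_Ici 0)
    (fun t _ => (hasDerivAt_HFun t).continuousAt.continuousWithinAt) fun t ht => ?_
  rw [interior_Ici] at ht
  rw [deriv_HFun, ← HFun'_zero]
  exact strictMono_HFun' ht

theorem continuous_HFun : Continuous HFun :=
  continuous_iff_continuousAt.2 fun t => (hasDerivAt_HFun t).continuousAt

theorem continuous_HFun' : Continuous HFun' :=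
  continuous_iff_continuousAt.2 fun t => (hasDerivAt_HFun' t).continuousAt

theorem strictConvexOn_HFun : StrictConvexOn ℝ univ HFun :=
  strictConvexOn_univ_of_deriv2_pos continuous_HFun fun t => deriv_deriv_HFun_pos t

theorem tendsto_HFun : Tendsto HFun atTop atTop := by
  refine tendsto_atTop_mono (fun t => (two_mul_add_log_lt_HFun t).le) ?_
  exact (tendsto_atTop_add_const_right _ _ tendsto_id).const_mul_atTop two_pos

theorem image_HFun_Ici : HFun '' Ici 0 = Ici (2 * hempelC) := by
  apply Subset.antisymm
  · rintro _ ⟨t, ht, rfl⟩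
    rw [mem_Ici, ← HFun_zero]
    exact strictMonoOn_HFun.monotoneOn self_mem_Ici ht ht
  · intro y hy
    rw [mem_Ici, ← HFun_zero] at hy
    obtain ⟨b, hb0, hb⟩ := ((eventually_ge_atTop 0).and
      (tendsto_HFun.eventually_ge_atTop y)).exists
    obtain ⟨t, ht, rfl⟩ := intermediate_value_Icc hb0 continuous_HFun.continuousOn ⟨hy, hb⟩
    exact ⟨t, ht.1, rfl⟩

theorem range_HFun' : range HFun' = Ioo (-2) 2 := by
  apply Subset.antisymm
  · rintro _ ⟨t, rfl⟩
    have := HFun'_lt_two (-t)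
    rw [HFun'_neg] at this
    exact ⟨by linarith, HFun'_lt_two t⟩
  · rintro y ⟨h1, h2⟩
    obtain ⟨b, hb⟩ := (tendsto_HFun'.eventually_const_lt h2).exists
    obtain ⟨a, ha⟩ := (tendsto_HFun'.eventually_const_lt (neg_lt.1 h1)).exists
    refine mem_range_of_exists_le_of_exists_ge continuous_HFun' ⟨-a, ?_⟩ ⟨b, hb.le⟩
    rw [HFun'_neg]
    linarith

theorem hFun_eq_inv (t : ℝ) : hFun t = (HFun t)⁻¹ := by simp [HFun]

theorem strictMonoOn_mul_hFun : StrictMonoOn (fun t : ℝ => t * hFun t) (Ioi 0) := by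
  have hd : ∀ t, HasDerivAt (fun t : ℝ => t * hFun t)
      ((HFun t - t * HFun' t) / HFun t ^ 2) t := by
    intro t
    simp only [hFun_eq_inv]
    have h0 := (HFun_pos t).ne'
    refine ((hasDerivAt_id t).mul ((hasDerivAt_HFun t).inv h0)).congr_deriv ?_
    simp only [id, Pi.inv_apply]
    field_simp
    ring
  refine strictMonoOn_of_deriv_pos (convex_Ioi 0)
    (fun t _ => (hd t).continuousAt.continuousWithinAt) fun t ht => ?_
  rw [interior_Ioi] at ht
  rw [(hd t).deriv]
  have ht0 : 0 < t := ht
  have h1 := two_mul_add_log_lt_HFun t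
  have h2 : 0 < log 16 := log_pos (by norm_num)
  have h3 := mul_lt_mul_of_pos_left (HFun'_lt_two t) ht0
  have h4 := HFun_pos t
  exact div_pos (by linarith) (by positivity)

theorem image_mul_hFun : (fun t : ℝ => t * hFun t) '' Ioi 0 = Ioo 0 (1 / 2) := by
  have hcont : Continuous fun t : ℝ => t * hFun t := by
    simp only [hFun_eq_inv]
    exact continuous_id.mul (continuous_HFun.inv₀ fun t => (HFun_pos t).ne')
  apply Subset.antisymm
  · rintro _ ⟨t, ht, rfl⟩
    have ht0 : 0 < t := ht
    have h4 := HFun_pos t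
    have h1 := two_mul_add_log_lt_HFun t
    have h2 : 0 < log 16 := log_pos (by norm_num)
    simp only [hFun_eq_inv]
    refine ⟨by positivity, ?_⟩
    rw [← div_eq_mul_inv, div_lt_iff₀ h4]
    linarith
  · rintro y ⟨h1, h2⟩
    have hlim : Tendsto (fun t : ℝ => t * hFun t) atTop (𝓝 (1 / 2)) := by
      have h3 : Tendsto (fun t : ℝ => HFun t / t) atTop (𝓝 2) := by
        have := (tendsto_HFun_sub.mul tendsto_inv_atTop_zero).add_const 2
        rw [mul_zero, zero_add] at this
        refine this.congr' ?_
        filter_upwards [eventually_gt_atTop 0] with t ht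
        field_simp
        ring
      have := h3.inv₀ two_ne_zero
      rw [inv_eq_one_div] at this
      refine this.congr fun t => ?_
      rw [hFun_eq_inv, inv_div, div_eq_mul_inv]
    obtain ⟨b, hb0, hb⟩ := ((eventually_gt_atTop 0).and (hlim.eventually_const_lt h2)).exists
    obtain ⟨t, ht, rfl⟩ := intermediate_value_Icc (le_of_lt hb0) hcont.continuousOn
      (show y ∈ Icc _ _ from ⟨by simpa using h1.le, hb.le⟩)
    refine ⟨t, lt_of_le_of_ne ht.1 ?_, rfl⟩
    rintro rfl
    simp at h1

/-! ### An elementary minorant of `K` near the singular point -/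

/-- The beginning of the logarithmic expansion of `K` at the singular point, in terms of the
complementary parameter `m = σ (-t)`: `K = (1/2) log (16 / m) (1 + m / 4) - m / 4 + O(m² log m)`. -/
noncomputable def logKMinorant (t : ℝ) : ℝ :=
  (log 16 - log (sigmoid (-t))) / 2 * (1 + sigmoid (-t) / 4) - sigmoid (-t) / 4

/-- The derivative of `logKMinorant`. -/
noncomputable def logKMinorant' (t : ℝ) : ℝ :=
  (1 - sigmoid (-t)) / 2 * (1 + sigmoid (-t) / 4)
    - (log 16 - log (sigmoid (-t))) * (sigmoid (-t) * (1 - sigmoid (-t))) / 8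
    + sigmoid (-t) * (1 - sigmoid (-t)) / 4

theorem hasDerivAt_sigmoid_neg (t : ℝ) :
    HasDerivAt (fun t => sigmoid (-t)) (-(sigmoid (-t) * (1 - sigmoid (-t)))) t :=
  ((hasDerivAt_sigmoid (-t)).comp t (hasDerivAt_neg t)).congr_deriv (by ring)

theorem hasDerivAt_log_sigmoid_neg (t : ℝ) :
    HasDerivAt (fun t => log 16 - log (sigmoid (-t))) (1 - sigmoid (-t)) t := by
  have h0 := (sigmoid_pos (-t)).ne'
  refine (((hasDerivAt_sigmoid_neg t).log h0).const_sub (log 16)).congr_deriv ?_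
  field_simp

theorem hasDerivAt_logKMinorant (t : ℝ) : HasDerivAt logKMinorant (logKMinorant' t) t := by
  have hm := hasDerivAt_sigmoid_neg t
  have hl := hasDerivAt_log_sigmoid_neg t
  refine (((hl.div_const 2).mul ((hm.div_const 4).const_add 1)).sub
    (hm.div_const 4)).congr_deriv ?_
  rw [logKMinorant']
  ring

/-- The minorant satisfies `y'' = q y - g` with an explicit `g`, which is nonnegative as soon as
`log (16 / m) ≥ 10/3`. -/
theorem hasDerivAt_logKMinorant' (t : ℝ) : HasDerivAt logKMinorant'
    (potential t * logKMinorant t - sigmoid (-t) ^ 2 * (1 - sigmoid (-t))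
      * (9 / 32 * (log 16 - log (sigmoid (-t))) - 15 / 16)) t := by
  have hm := hasDerivAt_sigmoid_neg t
  have hl := hasDerivAt_log_sigmoid_neg t
  have hmm := hm.mul (hm.const_sub 1)
  refine (((((hm.const_sub 1).div_const 2).mul ((hm.div_const 4).const_add 1)).sub
    ((hl.mul hmm).div_const 8)).add (hmm.div_const 4)).congr_deriv ?_
  rw [← potential_neg, potential, logKMinorant]
  simp only [Pi.mul_apply]
  ring

theorem log_sigmoid_neg (t : ℝ) : log (sigmoid (-t)) = log (sigmoid t) - t := by
  rw [← sigmoid_mul_rexp_neg, log_mul (sigmoid_pos t).ne' (exp_pos _).ne', log_exp]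
  ring

theorem tendsto_sigmoid_neg : Tendsto (fun t => sigmoid (-t)) atTop (𝓝 0) :=
  tendsto_sigmoid_atBot.comp tendsto_neg_atTop_atBot

theorem tendsto_log_sigmoid : Tendsto (fun t => log (sigmoid t)) atTop (𝓝 0) := by
  simpa using tendsto_sigmoid_atTop.log one_ne_zero

theorem tendsto_log_mul_sigmoid_neg :
    Tendsto (fun t => (log 16 - log (sigmoid (-t))) * sigmoid (-t)) atTop (𝓝 0) := by
  have h1 : Tendsto (fun t => t * sigmoid (-t)) atTop (𝓝 0) := by
    have := tendsto_sigmoid_atTop.mul tendsto_mul_exp_neg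
    rw [mul_zero] at this
    refine this.congr fun t => ?_
    rw [← sigmoid_mul_rexp_neg]
    ring
  have h2 := ((tendsto_log_sigmoid.const_sub (log 16)).mul tendsto_sigmoid_neg).add h1
  rw [mul_zero, zero_add] at h2
  refine h2.congr fun t => ?_
  rw [log_sigmoid_neg]
  ring

theorem tendsto_logK_sub_minorant :
    Tendsto (fun t => logK t - logKMinorant t) atTop (𝓝 0) := by
  have h := ((tendsto_logK_sub.sub ((tendsto_log_sigmoid.const_sub (log 16)).div_const 2)).sub
    (tendsto_log_mul_sigmoid_neg.div_const 8)).add (tendsto_sigmoid_neg.div_const 4)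
  have e : 2 * log 2 - (log 16 - 0) / 2 - 0 / 8 + 0 / 4 = 0 := by
    rw [show (16 : ℝ) = 2 ^ 4 by norm_num, log_pow]
    push_cast
    ring
  rw [e] at h
  refine h.congr fun t => ?_
  rw [logKMinorant, log_sigmoid_neg]
  ring

theorem tendsto_logK'_sub_minorant :
    Tendsto (fun t => logK' t - logKMinorant' t) atTop (𝓝 0) := by
  have hm := tendsto_sigmoid_neg
  have h := tendsto_logK'.sub (((((hm.const_sub 1).div_const 2).mul
    ((hm.div_const 4).const_add 1)).sub
    ((tendsto_log_mul_sigmoid_neg.mul (hm.const_sub 1)).div_const 8)).add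
    ((hm.mul (hm.const_sub 1)).div_const 4))
  norm_num at h
  refine h.congr fun t => ?_
  rw [logKMinorant']
  ring

theorem sigmoid_neg_le_half {t : ℝ} (ht : 0 ≤ t) : sigmoid (-t) ≤ 1 / 2 := by
  have := sigmoid_le (neg_nonpos.2 ht)
  rwa [sigmoid_zero, inv_eq_one_div] at this

theorem log_sixteen_gt : 2.7725886 < log 16 := by
  rw [show (16 : ℝ) = 2 ^ 4 by norm_num, log_pow]
  push_cast
  linarith [log_two_gt_d9]

/-- Sturm comparison from `+∞`: with `d = logK - logKMinorant` and `v t = logK (-t)`, the Wronskian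
`d' v - d v'` increases to `0`, so `d / v` decreases to `0`. -/
theorem logKMinorant_le {t : ℝ} (ht : 0 ≤ t) : logKMinorant t ≤ logK t := by
  set d : ℝ → ℝ := fun t => logK t - logKMinorant t with hd
  set d' : ℝ → ℝ := fun t => logK' t - logKMinorant' t with hd'
  set W : ℝ → ℝ := fun t => d' t * logK (-t) + d t * logK' (-t) with hW
  have hdd : ∀ t, HasDerivAt d (d' t) t := fun t =>
    (hasDerivAt_logK t).sub (hasDerivAt_logKMinorant t)
  have hWd : ∀ t, HasDerivAt W (sigmoid (-t) ^ 2 * (1 - sigmoid (-t))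
      * (9 / 32 * (log 16 - log (sigmoid (-t))) - 15 / 16) * logK (-t)) t := by
    intro t
    refine ((((hasDerivAt_logK' t).sub (hasDerivAt_logKMinorant' t)).mul
      (hasDerivAt_logK_neg t)).add ((hdd t).mul (hasDerivAt_logK'_neg t))).congr_deriv ?_
    simp only [hd, hd', Pi.sub_apply]
    ring
  have hWmono : MonotoneOn W (Ici 0) := by
    refine monotoneOn_of_deriv_nonneg (convex_Ici 0)
      (fun t _ => (hWd t).continuousAt.continuousWithinAt)
      (fun t _ => (hWd t).differentiableAt.differentiableWithinAt) fun t ht => ?_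
    rw [interior_Ici] at ht
    rw [(hWd t).deriv]
    have h1 := sub_pos.2 (sigmoid_lt_one (-t))
    have h2 := logK_pos (-t)
    have h3 : log (sigmoid (-t)) ≤ -log 2 := by
      rw [← log_inv, inv_eq_one_div]
      exact log_le_log (sigmoid_pos _) (sigmoid_neg_le_half (le_of_lt ht))
    have h4 : 0 ≤ 9 / 32 * (log 16 - log (sigmoid (-t))) - 15 / 16 := by
      linarith [log_sixteen_gt, log_two_gt_d9]
    positivity
  have hWlim : Tendsto W atTop (𝓝 0) := by
    have := (tendsto_logK'_sub_minorant.mul tendsto_logK_neg).add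
      (tendsto_logK_sub_minorant.mul tendsto_logK'_neg)
    simpa using this
  have hWle : ∀ t, 0 ≤ t → W t ≤ 0 := by
    intro t ht
    refine ge_of_tendsto hWlim ?_
    filter_upwards [eventually_ge_atTop t] with x hx
    exact hWmono ht (ht.trans hx) hx
  have hquot : ∀ t, HasDerivAt (fun t => d t / logK (-t)) (W t / logK (-t) ^ 2) t := by
    intro t
    refine ((hdd t).div (hasDerivAt_logK_neg t) (logK_pos _).ne').congr_deriv ?_
    simp only [hW]
    ring
  have hanti : AntitoneOn (fun t => d t / logK (-t)) (Ici 0) := by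
    refine antitoneOn_of_deriv_nonpos (convex_Ici 0)
      (fun t _ => (hquot t).continuousAt.continuousWithinAt)
      (fun t _ => (hquot t).differentiableAt.differentiableWithinAt) fun t ht => ?_
    rw [interior_Ici] at ht
    rw [(hquot t).deriv]
    exact div_nonpos_of_nonpos_of_nonneg (hWle t (le_of_lt ht)) (sq_nonneg _)
  have hqlim : Tendsto (fun t => d t / logK (-t)) atTop (𝓝 0) := by
    have := tendsto_logK_sub_minorant.div tendsto_logK_neg (by positivity)
    rwa [zero_div] at this
  have h0 : 0 ≤ d t / logK (-t) := by
    refine le_of_tendsto hqlim ?_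
    filter_upwards [eventually_ge_atTop t] with x hx
    exact hanti ht (ht.trans hx) hx
  rw [le_div_iff₀ (logK_pos (-t)), zero_mul] at h0
  exact sub_nonneg.1 h0

/-! ### A numerical bound for `C₀` -/

/-- A polynomial majorant of `(1 + z)^(-1/2)` on `|z| ≤ 1/3`: the Taylor polynomial of degree four
with its last coefficient `35/128` raised to `2/5`. -/
theorem one_div_sqrt_one_add_le {z : ℝ} (h1 : -(1 / 3) ≤ z) (h2 : z ≤ 1 / 3) :
    1 / √(1 + z) ≤ 1 - z / 2 + 3 / 8 * z ^ 2 - 5 / 16 * z ^ 3 + 2 / 5 * z ^ 4 := by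
  have hz : 0 < 1 + z := by linarith
  have hp : 0 < 1 - z / 2 + 3 / 8 * z ^ 2 - 5 / 16 * z ^ 3 + 2 / 5 * z ^ 4 := by
    nlinarith [sq_nonneg z, sq_nonneg (z ^ 2)]
  rw [div_le_iff₀ (sqrt_pos.2 hz), ← div_le_iff₀' hp]
  refine le_sqrt_of_sq_le ?_
  rw [div_pow, one_pow, div_le_iff₀ (by positivity)]
  have hq : 0 ≤ 81/320 + 99/160 * z - 303/1280 * z ^ 2 + 189/1280 * z ^ 3 - 9/100 * z ^ 4
      + 4/25 * z ^ 5 := by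
    nlinarith [sq_nonneg z, sq_nonneg (z ^ 2)]
  have : (1 + z) * (1 - z / 2 + 3 / 8 * z ^ 2 - 5 / 16 * z ^ 3 + 2 / 5 * z ^ 4) ^ 2 - 1
    = z ^ 4 * (81/320 + 99/160 * z - 303/1280 * z ^ 2 + 189/1280 * z ^ 3 - 9/100 * z ^ 4
      + 4/25 * z ^ 5) := by ring
  have h4 : 0 ≤ z ^ 4 := by positivity
  nlinarith [mul_nonneg h4 hq]

/-- An upper bound for `K(1/√2)`, from `1 - sin²θ / 2 = (3/4) (1 + cos (2θ) / 3)` and the preceding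
majorant. -/
theorem logK_zero_le : logK 0 ≤ 2 / √3 * (π / 2 * (2209 / 2160)) := by
  have hd : ∀ θ : ℝ, HasDerivAt
      (fun θ : ℝ => 2209 / 2160 * θ + sin (2 * θ) / 2 * (-(1 / 6) + 1 / 48 * cos (2 * θ)
        - 5 / 1296 * (2 + cos (2 * θ) ^ 2)
        + 2 / 405 * cos (2 * θ) * (3 / 8 + 1 / 4 * cos (2 * θ) ^ 2)))
      (1 - cos (2 * θ) / 3 / 2 + 3 / 8 * (cos (2 * θ) / 3) ^ 2 - 5 / 16 * (cos (2 * θ) / 3) ^ 3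
        + 2 / 5 * (cos (2 * θ) / 3) ^ 4) θ := by
    intro θ
    have h2 : HasDerivAt (fun θ : ℝ => 2 * θ) 2 θ := by
      simpa using (hasDerivAt_id θ).const_mul (2 : ℝ)
    have hs := h2.sin
    have hc := h2.cos
    have h := ((hasDerivAt_id θ).const_mul (2209 / 2160 : ℝ)).add ((hs.div_const 2).mul
      ((((hc.const_mul (1 / 48 : ℝ)).const_add (-(1 / 6) : ℝ)).sub
        (((hc.pow 2).const_add (2 : ℝ)).const_mul (5 / 1296 : ℝ))).add
        ((hc.const_mul (2 / 405 : ℝ)).mul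
          (((hc.pow 2).const_mul (1 / 4 : ℝ)).const_add (3 / 8 : ℝ)))))
    refine h.congr_deriv ?_
    simp only [Pi.add_apply, Pi.sub_apply, Pi.mul_apply, Pi.pow_apply]
    have e := sin_sq_add_cos_sq (2 * θ)
    have e' : sin (2 * θ) ^ 2 = 1 - cos (2 * θ) ^ 2 := by linarith
    ring_nf
    ring_nf at e'
    rw [e']
    ring
  have hcont : Continuous fun θ : ℝ => 1 - cos (2 * θ) / 3 / 2 + 3 / 8 * (cos (2 * θ) / 3) ^ 2
      - 5 / 16 * (cos (2 * θ) / 3) ^ 3 + 2 / 5 * (cos (2 * θ) / 3) ^ 4 := by fun_prop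
  have hI := intervalIntegral.integral_eq_sub_of_hasDerivAt (a := 0) (b := π / 2)
    (fun θ _ => hd θ) (hcont.intervalIntegrable _ _)
  rw [show 2 * (π / 2) = π by ring] at hI
  simp only [sin_pi, mul_zero, sin_zero, zero_div, zero_mul, add_zero, sub_zero] at hI
  rw [mul_comm (π / 2), ← hI, ← intervalIntegral.integral_const_mul, logK, sigmoid_zero,
    show (2⁻¹ : ℝ) = 1 / 2 by norm_num, ellipticMoment_zero_half (by norm_num)]
  refine intervalIntegral.integral_mono_on (by positivity)
    ((continuous_one_div_sqrt (by norm_num)).intervalIntegrable _ _)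
    ((hcont.const_mul _).intervalIntegrable _ _) fun θ _ => ?_
  have e : 1 - 1 / 2 * sin θ ^ 2 = 3 / 4 * (1 + cos (2 * θ) / 3) := by
    rw [cos_two_mul, cos_sq']
    ring
  have e4 : √(3 / 4 : ℝ) = √3 / 2 := by
    rw [sqrt_div (by norm_num), show (4 : ℝ) = 2 ^ 2 by norm_num, sqrt_sq zero_le_two]
  rw [e, sqrt_mul (by norm_num), e4, one_div, mul_inv, inv_div, ← one_div (√(1 + _))]
  refine mul_le_mul_of_nonneg_left (one_div_sqrt_one_add_le ?_ ?_) (by positivity)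
  · linarith [neg_one_le_cos (2 * θ)]
  · linarith [cos_le_one (2 * θ)]

theorem hempelC_lt : hempelC < 4.3811 := by
  have h := HFun_zero
  rw [HFun_eq, neg_zero] at h
  have h1 := logK_zero_le
  have h2 : logK 0 * logK 0 ≤ (2 / √3 * (π / 2 * (2209 / 2160))) ^ 2 := by
    rw [← sq]
    exact pow_le_pow_left₀ (logK_pos 0).le h1 2
  have h3 : (2 / √3 * (π / 2 * (2209 / 2160))) ^ 2 = π * (π * (1 / 3 * (2209 / 2160) ^ 2)) := by
    rw [mul_pow, div_pow, sq_sqrt (by norm_num)]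
    ring
  rw [h3] at h2
  have h4 : 2 * hempelC ≤ 8 * (π * (1 / 3 * (2209 / 2160) ^ 2)) := by
    rw [← h, div_mul_eq_mul_div, div_le_iff₀ pi_pos]
    linarith
  have := pi_lt_d4
  norm_num at *
  linarith

/-! ### The bound `(8/5) (|t| + C₀) < H(t)` -/

/-- The tangent line of the convex function `-log` at `1 / c`. -/
theorem neg_log_ge {m c : ℝ} (hm : 0 < m) (hc : 0 < c) : log c + 1 - c * m ≤ -log m := by
  have h := log_le_sub_one_of_pos (mul_pos hc hm)
  rw [log_mul hc.ne' hm.ne'] at h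
  linarith

/-- In `-log m` the asserted inequality is linear with the positive slope
`2 / 5 + m + m² / 8`. On each of four ranges of `m` it follows from one tangent line of `-log`. -/
theorem minorant_ineq {m : ℝ} (hm : 0 < m) (hm2 : m ≤ 1 / 2) :
    8 / 5 * (-log m - m + 4.3811)
      < 2 * (2.7725886 + -log m) * (1 + m / 4) ^ 2 - m * (1 + m / 4) := by
  have key : ∀ T : ℝ, T ≤ -log m →
      8 / 5 * (T - m + 4.3811) < 2 * (2.7725886 + T) * (1 + m / 4) ^ 2 - m * (1 + m / 4) →
      8 / 5 * (-log m - m + 4.3811)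
        < 2 * (2.7725886 + -log m) * (1 + m / 4) ^ 2 - m * (1 + m / 4) := by
    intro T hT h
    nlinarith [mul_nonneg (sub_nonneg.2 hT) (show 0 ≤ 2 / 5 + m + m ^ 2 / 8 by positivity)]
  have l2 := log_two_gt_d9
  have l3 := log_three_gt_d9
  rcases le_total m (7 / 100) with h1 | h1
  · have hl : log 16 = 4 * log 2 := by
      rw [show (16 : ℝ) = 2 ^ 4 by norm_num, log_pow]; norm_num
    have h := neg_log_ge hm (c := 16) (by norm_num)
    refine key (3.772588 - 16 * m) (by linarith) ?_
    nlinarith [mul_nonneg hm.le (sub_nonneg.2 h1), mul_nonneg (sq_nonneg m) (sub_nonneg.2 h1)]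
  rcases le_total m (12 / 100) with h2 | h2
  · have hl : log 12 = 2 * log 2 + log 3 := by
      rw [show (12 : ℝ) = 2 ^ 2 * 3 by norm_num, log_mul (by norm_num) (by norm_num), log_pow]
      norm_num
    have h := neg_log_ge hm (c := 12) (by norm_num)
    refine key (3.484906 - 12 * m) (by linarith) ?_
    nlinarith [mul_nonneg (sub_nonneg.2 h1) (sub_nonneg.2 h2),
      mul_nonneg hm.le (mul_nonneg (sub_nonneg.2 h1) (sub_nonneg.2 h2))]
  rcases le_total m (25 / 100) with h3 | h3
  · have hl : log 8 = 3 * log 2 := by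
      rw [show (8 : ℝ) = 2 ^ 3 by norm_num, log_pow]; norm_num
    have h := neg_log_ge hm (c := 8) (by norm_num)
    refine key (3.079441 - 8 * m) (by linarith) ?_
    nlinarith [mul_nonneg (sub_nonneg.2 h2) (sub_nonneg.2 h3),
      mul_nonneg hm.le (mul_nonneg (sub_nonneg.2 h2) (sub_nonneg.2 h3))]
  · have hl : log 4 = 2 * log 2 := by
      rw [show (4 : ℝ) = 2 ^ 2 by norm_num, log_pow]; norm_num
    have h := neg_log_ge hm (c := 4) (by norm_num)
    refine key (2.386294 - 4 * m) (by linarith) ?_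
    nlinarith [mul_nonneg (sub_nonneg.2 h3) (sub_nonneg.2 hm2),
      mul_nonneg hm.le (mul_nonneg (sub_nonneg.2 h3) (sub_nonneg.2 hm2))]

theorem eight_fifths_lt_HFun (t : ℝ) : 8 / 5 * (|t| + hempelC) < HFun t := by
  have key : ∀ s : ℝ, 0 ≤ s → 8 / 5 * (s + hempelC) < HFun s := by
    intro s hs
    set m := sigmoid (-s) with hm
    have hm0 : 0 < m := sigmoid_pos _
    have h1 := logKMinorant_le hs
    have h2 := le_logK_neg s
    rw [← hm] at h2
    have h3 : logKMinorant s * (π / 2 * (1 + m / 4)) ≤ logK s * logK (-s) :=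
      (mul_le_mul_of_nonneg_right h1 (by positivity)).trans
        (mul_le_mul_of_nonneg_left h2 (logK_pos s).le)
    have h4 : 4 * logKMinorant s * (1 + m / 4) ≤ HFun s := by
      rw [HFun_eq]
      calc 4 * logKMinorant s * (1 + m / 4)
          = 8 / π * (logKMinorant s * (π / 2 * (1 + m / 4))) := by field_simp; ring
        _ ≤ _ := by gcongr
    have h5 : s ≤ -log m - m := by
      have e1 := log_sigmoid_neg s
      have e2 := log_le_sub_one_of_pos (sigmoid_pos s)
      have e3 := sigmoid_neg s
      rw [← hm] at e1 e3
      linarith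
    have h6 := minorant_ineq hm0 (sigmoid_neg_le_half hs)
    have h7 := hempelC_lt
    have h8 : 4 * logKMinorant s * (1 + m / 4)
        = 2 * (log 16 - log m) * (1 + m / 4) ^ 2 - m * (1 + m / 4) := by
      rw [logKMinorant, ← hm]
      ring
    have h9 : 2 * (2.7725886 + -log m) * (1 + m / 4) ^ 2
        ≤ 2 * (log 16 - log m) * (1 + m / 4) ^ 2 := by
      have := log_sixteen_gt
      gcongr
      linarith
    linarith
  rcases abs_cases t with ⟨h, h'⟩ | ⟨h, h'⟩ <;> rw [h]
  · exact key t h'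
  · rw [← HFun_even]
    exact key (-t) (by linarith)

/-! ### Conclusion -/

theorem mainTheorem1 :
    -- `t h(t)` increases strictly from `(0, ∞)` onto `(0, 1/2)`
    (StrictMonoOn (fun t : ℝ => t * hFun t) (Set.Ioi 0) ∧
      (fun t : ℝ => t * hFun t) '' Set.Ioi 0 = Set.Ioo 0 (1 / 2)) ∧
    -- `H` is even, twice differentiable, `H'' > 0`, strictly convex,
    -- and maps `[0, ∞)` homeomorphically onto `[2 C₀, ∞)`
    (Function.Even HFun ∧ Differentiable ℝ HFun ∧ Differentiable ℝ (deriv HFun) ∧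
      (∀ t : ℝ, 0 < deriv (deriv HFun) t) ∧
      StrictConvexOn ℝ Set.univ HFun ∧
      ∃ e : Set.Ici (0 : ℝ) ≃ₜ Set.Ici (2 * hempelC),
        ∀ t : Set.Ici (0 : ℝ), (e t : ℝ) = HFun t) ∧
    -- `H'` is odd and maps `ℝ` homeomorphically onto `(-2, 2)`
    (Function.Odd (deriv HFun) ∧
      ∃ e : ℝ ≃ₜ Set.Ioo (-2 : ℝ) 2, ∀ t : ℝ, (e t : ℝ) = deriv HFun t) ∧
    (∀ t : ℝ, 2 * (|t| + hempelC) * hFun t < 1.25) ∧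
    -- the two-sided bound; the lower one is strict except at `t = 0`, where it is an equality
    (∀ t : ℝ, 1 / (|t| + hempelC) ≤ 2 * hFun t ∧
      (1 / (|t| + hempelC) = 2 * hFun t ↔ t = 0) ∧
      2 * hFun t < 1 / (|t| + Real.log 16)) := by
  refine ⟨⟨strictMonoOn_mul_hFun, image_mul_hFun⟩, ⟨HFun_even,
    fun t => (hasDerivAt_HFun t).differentiableAt, ?_, deriv_deriv_HFun_pos, strictConvexOn_HFun,
    ?_⟩, ⟨?_, ?_⟩, fun t => ?_, fun t => ?_⟩
  · rw [deriv_HFun]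
    exact fun t => (hasDerivAt_HFun' t).differentiableAt
  · -- A strictly monotone bijection between intervals is a homeomorphism for the order topologies.
    let e := (strictMonoOn_HFun.orderIso HFun (Set.Ici 0)).toEquiv.trans
      (Equiv.setCongr image_HFun_Ici)
    have he : ∀ t, (e t : ℝ) = HFun t := fun t => rfl
    let o : Set.Ici (0 : ℝ) ≃o Set.Ici (2 * hempelC) :=
      { toEquiv := e
        map_rel_iff' := fun {a b} => by
          rw [← Subtype.coe_le_coe, he, he]
          exact strictMonoOn_HFun.le_iff_le a.2 b.2 }
    exact ⟨o.toHomeomorph, he⟩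
  · rw [deriv_HFun]
    exact HFun'_neg
  · let e := (Equiv.ofInjective HFun' strictMono_HFun'.injective).trans
      (Equiv.setCongr range_HFun')
    have he : ∀ t, (e t : ℝ) = HFun' t := fun t => rfl
    let o : ℝ ≃o Set.Ioo (-2 : ℝ) 2 :=
      { toEquiv := e
        map_rel_iff' := fun {a b} => by
          rw [← Subtype.coe_le_coe, he, he]
          exact strictMono_HFun'.le_iff_le }
    rw [deriv_HFun]
    exact ⟨o.toHomeomorph, he⟩
  · rw [hFun_eq_inv, ← div_eq_mul_inv, div_lt_iff₀ (HFun_pos t)]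
    linarith [eight_fifths_lt_HFun t]
  · have hH := HFun_pos t
    have hC : 0 < hempelC := by linarith [HFun_pos 0, HFun_zero]
    have hl : 0 < Real.log 16 := Real.log_pos (by norm_num)
    have ha := abs_nonneg t
    have hle : t ≠ 0 → 1 / (|t| + hempelC) < 2 * hFun t := by
      intro ht
      rw [hFun_eq_inv, ← div_eq_mul_inv, div_lt_div_iff₀ (by positivity) hH]
      linarith [HFun_lt_of_ne ht]
    have heq : t = 0 → 1 / (|t| + hempelC) = 2 * hFun t := by
      rintro rfl
      rw [hFun_eq_inv, HFun_zero, abs_zero, zero_add]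
      field_simp
    refine ⟨?_, ⟨fun h => ?_, heq⟩, ?_⟩
    · by_cases ht : t = 0
      · exact (heq ht).le
      · exact (hle ht).le
    · by_contra ht
      exact (hle ht).ne h
    · rw [hFun_eq_inv, ← div_eq_mul_inv, div_lt_div_iff₀ hH (by positivity)]
      linarith [two_mul_abs_add_log_lt_HFun t]
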